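/- Let $(X,d)$ be a complete separable metric space and fix $x_0\in X$. Let $h_1,\dots,h_k:X\to X$ be Lipschitz maps and let $p_1,\dots,p_k:X\to[0,1]$ be functions with $\sum_i p_i(x)=1$ for all $x$, bounded away from $0$ and satisfying the Dini condition (for the modulus of continuity $\varphi_i(t)=\sup\{|p_i(x)-p_i(y)|: d(x,y)\le t\}$ one has $\int_0^\delta \varphi_i(t)\,\frac{dt}{t}<\infty$ for some $\delta>0$). Assume that the system is contracting on average: there is $b>0$ such that, with $\log 0=-\infty$, $$\sum_{j=1}^k p_j(x)\log\frac{d(h_j(x),h_j(y))}{d(x,y)}<-b\qquad\text{for all } x\neq y .$$ Let $\nu$ be an invariant probability measure of the system, that is, a Borel probability measure with $\nu=\sum_i (h_i)_*(p_i\cdot\nu)$. Let $\Sigma=\{1,\dots,k\}^{\mathbb N}$ with left shift $\sigma$. Let $\mu_+$ be the probability measure on $\Sigma$ which gives the cylinder of sequences beginning with $\omega_1\dots\omega_n$ the mass $\int_X\prod_{i=1}^n p_{\omega_i}(h_{\omega_{i-1}}\circ\dots\circ h_{\omega_1}(x))\,d\nu(x)$, let $\mu$ be its natural extension, i.e. the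 shift-invariant measure on $\{1,\dots,k\}^{\mathbb Z}$ whose image under $\omega\mapsto(\omega_1,\omega_2,\dots)$ is $\mu_+$, and let $\mu_-$ be the image of $\mu$ under $\omega\mapsto(\omega_0,\omega_{-1},\omega_{-2},\dots)$. Then these measures exist, $\mu_-$ is a $\sigma$-invariant probability measure on $\Sigma$, the limit $$\pi(\omega)=\lim_{n\to\infty}h_{\omega_1}\circ h_{\omega_2}\circ\dots\circ h_{\omega_n}(x_0)$$ exists for $\mu_-$-almost every $\omega\in\Sigma$, and $\nu=\pi_*(\mu_-)$. -/

import Mathlib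

open MeasureTheory Filter Topology

namespace PlaceDependentIFS

/-- The modulus of continuity `t ↦ sup {|f x - f y| : dist x y ≤ t}`, with values in `[0, ∞]`. -/
noncomputable def modulus {X : Type*} [MetricSpace X] (f : X → ℝ) (t : ℝ) : ENNReal :=
  ⨆ (x : X) (y : X) (_ : dist x y ≤ t), ENNReal.ofReal |f x - f y|

/-- The Dini condition: the modulus of continuity `φ` satisfies `∫₀^δ φ(t) / t dt < ∞` for some
`δ > 0`. -/
def DiniContinuous {X : Type*} [MetricSpace X] (f : X → ℝ) : Prop :=
  ∃ δ : ℝ, 0 < δ ∧ ∫⁻ t in Set.Ioc 0 δ, modulus f t / ENNReal.ofReal t < ⊤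

/-- `(p₁(x), …, p_k(x))` is a probability vector for every `x`. -/
def IsProbabilityVectorField {X : Type*} {k : ℕ} (p : Fin k → X → ℝ) : Prop :=
  ∀ x, (∀ i, 0 ≤ p i x) ∧ ∑ i, p i x = 1

/-- The functions `p_i` are uniformly bounded away from `0`. -/
def BoundedAwayFromZero {X : Type*} {k : ℕ} (p : Fin k → X → ℝ) : Prop :=
  ∃ c : ℝ, 0 < c ∧ ∀ i x, c ≤ p i x

/-- Contraction on average:
`∑ j, p_j(x) log (d(h_j x, h_j y) / d(x, y)) < -b < 0` uniformly in `x ≠ y`.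
The logarithm takes values in the extended reals, with `log 0 = -∞`. -/
def ContractingOnAverage {X : Type*} [MetricSpace X] {k : ℕ}
    (h : Fin k → X → X) (p : Fin k → X → ℝ) : Prop :=
  ∃ b : ℝ, 0 < b ∧ ∀ x y, x ≠ y →
    ∑ j, ((p j x : ℝ) : EReal) *
      ENNReal.log (ENNReal.ofReal (dist (h j x) (h j y) / dist x y)) < ((-b : ℝ) : EReal)

/-- The operator `F(ν) = ∑ i, (h_i)_* (p_i · ν)`. -/
noncomputable def transfer {X : Type*} [MeasurableSpace X] {k : ℕ}
    (h : Fin k → X → X) (p : Fin k → X → ℝ) (ν : Measure X) : Measure X :=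
  ∑ i, (ν.withDensity (fun x => ENNReal.ofReal (p i x))).map (h i)

/-- `ν` is an invariant probability measure of the system: `ν = F(ν)`. -/
structure IsInvariantMeasure {X : Type*} [MeasurableSpace X] {k : ℕ}
    (h : Fin k → X → X) (p : Fin k → X → ℝ) (ν : Measure X) : Prop where
  isProbabilityMeasure : IsProbabilityMeasure ν
  eq_transfer : ν = transfer h p ν

/-- The left shift on one-sided sequences. A sequence `ω₁ ω₂ …` is stored as
`ω 0, ω 1, …`. -/
def shift {k : ℕ} (ω : ℕ → Fin k) : ℕ → Fin k := fun n => ω (n + 1)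

/-- The left shift on two-sided sequences. -/
def shiftZ {k : ℕ} (ω : ℤ → Fin k) : ℤ → Fin k := fun i => ω (i + 1)

/-- The cylinder of all sequences having the same first `n` symbols as `ω`. -/
def cylinder {k : ℕ} (ω : ℕ → Fin k) (n : ℕ) : Set (ℕ → Fin k) :=
  {η | ∀ i < n, η i = ω i}

/-- `h_{ω^n} = h_{ω_n} ∘ ⋯ ∘ h_{ω_1}`. -/
def forwardIter {X : Type*} {k : ℕ} (h : Fin k → X → X) (ω : ℕ → Fin k) : ℕ → X → X
  | 0 => id
  | n + 1 => h (ω n) ∘ forwardIter h ω n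

/-- `h_{ω^{-n}} = h_{ω_1} ∘ ⋯ ∘ h_{ω_n}`. -/
def backwardIter {X : Type*} {k : ℕ} (h : Fin k → X → X) (ω : ℕ → Fin k) : ℕ → X → X
  | 0 => id
  | n + 1 => backwardIter h ω n ∘ h (ω n)

/-- `p_{ω^n}(x) = ∏_{i = 1}^n p_{ω_i}(h_{ω^{i-1}}(x))`, the probability that the random orbit of
`x` uses the symbols `ω_1, …, ω_n`. -/
noncomputable def wordProb {X : Type*} {k : ℕ} (h : Fin k → X → X) (p : Fin k → X → ℝ)
    (ω : ℕ → Fin k) (n : ℕ) (x : X) : ℝ :=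
  ∏ i ∈ Finset.range n, p (ω i) (forwardIter h ω i x)

/-- `μp = ∫ p_x dν(x)`, where `p_x` is the probability measure giving each cylinder `C_{ω^n}` the
mass `p_{ω^n}(x)`. A probability measure on sequences is determined by its values on cylinders. -/
structure IsForwardMeasure {X : Type*} [MeasurableSpace X] {k : ℕ}
    (h : Fin k → X → X) (p : Fin k → X → ℝ) (ν : Measure X)
    (μp : Measure (ℕ → Fin k)) : Prop where
  isProbabilityMeasure : IsProbabilityMeasure μp
  apply_cylinder : ∀ (ω : ℕ → Fin k) (n : ℕ),
    μp (cylinder ω n) = ∫⁻ x, ENNReal.ofReal (wordProb h p ω n x) ∂ν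

/-- The positive coordinates `ω₁ ω₂ ω₃ …` of a two-sided sequence. -/
def future {k : ℕ} (ω : ℤ → Fin k) : ℕ → Fin k := fun n => ω ((n : ℤ) + 1)

/-- The nonpositive coordinates `ω₀ ω₋₁ ω₋₂ …` of a two-sided sequence, read backwards. -/
def past {k : ℕ} (ω : ℤ → Fin k) : ℕ → Fin k := fun n => ω (-(n : ℤ))

/-- `μ` is the natural extension of `μp`: the shift-invariant measure on two-sided sequences whose
marginal on the positive coordinates is `μp`. -/
structure IsNaturalExtension {k : ℕ} (μp : Measure (ℕ → Fin k))
    (μ : Measure (ℤ → Fin k)) : Prop where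
  invariant : MeasurePreserving shiftZ μ μ
  map_future : μ.map future = μp

/-- The coding map `π(ω) = lim_n h_{ω^{-n}}(x₀)`. Where the limit does not exist the value is an
unspecified point. -/
noncomputable def codingMap {X : Type*} [MetricSpace X] {k : ℕ}
    (h : Fin k → X → X) (x₀ : X) (ω : ℕ → Fin k) : X :=
  haveI : Nonempty X := ⟨x₀⟩
  limUnder atTop (fun n => backwardIter h ω n x₀)

end PlaceDependentIFS

/-! The logarithm is traded for a small power. Expanding `r ^ s = exp (s log r)` for the ratios `r =
d(h_i x, h_i y) / d(x, y)` turns a mean logarithm below `-b` into `∑ p_i(x) d(h_i x, h_i y)^s ≤ ρ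
d(x, y)^s` with `ρ < 1` (`ContractingOnAverage.exists_sum_mul_edist_rpow_le`). The weights are taken
at `x` alone. Hence, along the random symbols drawn by the orbit of `x`, the orbit of any other
point `y` approaches it at rate `ρ ^ n` in mean `d ^ s` (`lintegral_walk_edist_forwardIter_le`), and
the values of `p_i` at different points never have to be compared. The Dini condition serves to make
`p_i` continuous, hence measurable.

The same contraction makes `d(·, x₀)^s` a Lyapunov function, so it is `ν`-integrable
(`IsInvariantMeasure.lintegral_lt_top_of_drift`). Started from `ν`, the symbols form a stationary
process; recentring ever longer words and passing to a limit by compactness gives the two-sided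
measure (`IsInvariantMeasure.exists_twoSided`).

A backward composition along the past is a forward composition along a window ending at time `0`.
Successive backward iterates are therefore at mean `d ^ s` distance `O(ρ ^ n)`, and almost surely
form a Cauchy sequence (`ae_cauchySeq_backwardIter`). Their law is close to that of the orbit
started from `ν`, which is `ν` at every time (`IsInvariantMeasure.tendsto_lintegral_backwardIter`),
so the limit has law `ν`. -/

namespace PlaceDependentIFS

open scoped ENNReal NNReal

/-! ### Continuity from the Dini condition -/

section Dini

variable {X : Type*} [MetricSpace X]

/-- Otherwise the Dini integrand dominates `ε / t`, which is not integrable at `0`. -/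
theorem DiniContinuous.exists_modulus_lt {f : X → ℝ} (hf : DiniContinuous f) {ε : ℝ}
    (hε : 0 < ε) : ∃ t : ℝ, 0 < t ∧ modulus f t < ENNReal.ofReal ε := by
  obtain ⟨δ, hδ, hint⟩ := hf
  by_contra! hcon
  have hle : ∫⁻ t in Set.Ioc 0 δ, ENNReal.ofReal (ε * t⁻¹) < ⊤ := by
    refine lt_of_le_of_lt (setLIntegral_mono' measurableSet_Ioc fun t ht => ?_) hint
    rw [ENNReal.ofReal_mul hε.le, ENNReal.ofReal_inv_of_pos ht.1, ← div_eq_mul_inv]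
    exact ENNReal.div_le_div_right (hcon t ht.1) _
  have hI : IntegrableOn (fun t : ℝ => ε * t⁻¹) (Set.Ioc 0 δ) := by
    refine ⟨by fun_prop, ?_⟩
    rw [hasFiniteIntegral_iff_ofReal]
    · exact hle
    · filter_upwards [ae_restrict_mem measurableSet_Ioc] with t ht
      have := ht.1
      positivity
  have hI' : IntervalIntegrable (fun t : ℝ => t⁻¹) volume 0 δ := by
    rw [intervalIntegrable_iff_integrableOn_Ioc_of_le hδ.le]
    simpa [hε.ne', IntegrableOn] using hI.const_mul ε⁻¹
  rw [intervalIntegrable_inv_iff] at hI'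
  rcases hI' with h | h
  · exact hδ.ne h
  · exact h Set.left_mem_uIcc

theorem DiniContinuous.continuous {f : X → ℝ} (hf : DiniContinuous f) : Continuous f := by
  rw [Metric.continuous_iff]
  intro x ε hε
  obtain ⟨t, ht, hlt⟩ := hf.exists_modulus_lt hε
  refine ⟨t, ht, fun y hy => ?_⟩
  have : ENNReal.ofReal |f y - f x| ≤ modulus f t :=
    le_iSup_of_le y (le_iSup_of_le x (le_iSup_of_le hy.le le_rfl))
  rw [Real.dist_eq]
  exact (ENNReal.ofReal_lt_ofReal_iff hε).1 (this.trans_lt hlt)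

end Dini

/-! ### From contraction of the mean logarithm to contraction of `d ^ s` -/

section Contraction

theorem ereal_coe_sum {ι : Type*} (t : Finset ι) (f : ι → ℝ) :
    ((∑ i ∈ t, f i : ℝ) : EReal) = ∑ i ∈ t, ((f i : ℝ) : EReal) := by
  classical
  induction t using Finset.induction_on with
  | empty => simp
  | insert a t ha ih => rw [Finset.sum_insert ha, Finset.sum_insert ha, EReal.coe_add, ih]

/-- Truncation makes the logarithms bounded. The level `-T`, `T = (log L + b) / c`, is low enough
that one truncated term, of weight at least `c`, outweighs the at most `log L` from all the others;
if no term is truncated, the hypothesis applies directly. -/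
theorem sum_mul_truncated_log_le {ι : Type*} [Fintype ι] {c b L : ℝ} (hc : 0 < c) (hb : 0 < b)
    (hL : 1 ≤ L) {q r : ι → ℝ} (hq : ∀ i, c ≤ q i) (hq1 : ∑ i, q i = 1)
    (hrL : ∀ i, r i ≤ L)
    (hlog : ∑ i, ((q i : ℝ) : EReal) * ENNReal.log (ENNReal.ofReal (r i)) < ((-b : ℝ) : EReal)) :
    ∑ i, q i * (if r i ≤ Real.exp (-((Real.log L + b) / c)) then -((Real.log L + b) / c)
      else Real.log (r i)) ≤ -b := by
  classical
  set T := (Real.log L + b) / c with hT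
  have hlogL : 0 ≤ Real.log L := Real.log_nonneg hL
  have hTpos : 0 < T := by positivity
  have hcT : c * T = Real.log L + b := by rw [hT]; field_simp
  have hq0 : ∀ i, 0 ≤ q i := fun i => hc.le.trans (hq i)
  by_cases hex : ∃ j, r j ≤ Real.exp (-T)
  · obtain ⟨j, hj⟩ := hex
    rw [← Finset.add_sum_erase _ _ (Finset.mem_univ j), if_pos hj]
    have h1 : ∑ i ∈ Finset.univ.erase j, q i * (if r i ≤ Real.exp (-T) then -T
        else Real.log (r i)) ≤ ∑ i ∈ Finset.univ.erase j, q i * Real.log L := by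
      refine Finset.sum_le_sum fun i _ => mul_le_mul_of_nonneg_left ?_ (hq0 i)
      split_ifs with h
      · linarith
      · exact Real.log_le_log ((Real.exp_pos _).trans (not_le.1 h)) (hrL i)
    have h2 : ∑ i ∈ Finset.univ.erase j, q i * Real.log L ≤ Real.log L := by
      rw [← Finset.sum_mul]
      refine mul_le_of_le_one_left hlogL ?_
      rw [← hq1]
      exact Finset.sum_le_sum_of_subset_of_nonneg (Finset.erase_subset _ _) fun i _ _ => hq0 i
    have h3 : c * T ≤ q j * T := mul_le_mul_of_nonneg_right (hq j) hTpos.le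
    linarith
  · push Not at hex
    have hpos : ∀ i, 0 < r i := fun i => (Real.exp_pos _).trans (hex i)
    have : ∑ i, ((q i : ℝ) : EReal) * ENNReal.log (ENNReal.ofReal (r i))
        = ((∑ i, q i * Real.log (r i) : ℝ) : EReal) := by
      rw [ereal_coe_sum]
      refine Finset.sum_congr rfl fun i _ => ?_
      rw [ENNReal.log_ofReal, if_neg (not_le.2 (hpos i)), EReal.coe_mul]
    rw [this, EReal.coe_lt_coe_iff] at hlog
    refine le_of_eq_of_le (Finset.sum_congr rfl fun i _ => ?_) hlog.le
    rw [if_neg (not_le.2 (hex i))]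

/-- If the mean of `log r` is at most `-b` then small moments of `r` are at most `ρ < 1`. -/
theorem exists_sum_mul_rpow_le {c b L : ℝ} (hc : 0 < c) (hb : 0 < b) (hL : 1 ≤ L) :
    ∃ s ρ : ℝ, 0 < s ∧ s ≤ 1 ∧ ρ < 1 ∧ ∀ (k : ℕ) (q r : Fin k → ℝ), (∀ i, c ≤ q i) →
      ∑ i, q i = 1 → (∀ i, 0 ≤ r i) → (∀ i, r i ≤ L) →
      ∑ i, ((q i : ℝ) : EReal) * ENNReal.log (ENNReal.ofReal (r i)) < ((-b : ℝ) : EReal) →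
      ∑ i, q i * r i ^ s ≤ ρ := by
  set T := (Real.log L + b) / c with hT
  have hlogL : 0 ≤ Real.log L := Real.log_nonneg hL
  have hTpos : 0 < T := by positivity
  set B := max (Real.log L) T with hB
  have hBpos : 0 < B := lt_max_of_lt_right hTpos
  -- `s * B ≤ 1` permits `exp y ≤ 1 + y + y ^ 2`, and `s * B ^ 2 ≤ b / 2` lets the quadratic error
  -- use up only half of the gain `s * b`.
  set s := min 1 (min (1 / B) (b / (2 * B ^ 2))) with hs
  have hs0 : 0 < s := by positivity
  have hs1 : s ≤ 1 := min_le_left _ _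
  have hsB : s * B ≤ 1 := by
    rw [← le_div_iff₀ hBpos]
    exact (min_le_right _ _).trans (min_le_left _ _)
  have hsb : s * (2 * B ^ 2) ≤ b := by
    rw [← le_div_iff₀ (by positivity)]
    exact (min_le_right _ _).trans (min_le_right _ _)
  refine ⟨s, 1 - s * b / 2, hs0, hs1, by have := mul_pos hs0 hb; linarith, ?_⟩
  intro k q r hq hq1 hr hrL hlog
  have hmean := sum_mul_truncated_log_le hc hb hL hq hq1 hrL hlog
  rw [← hT] at hmean
  have hq0 : ∀ i, 0 ≤ q i := fun i => hc.le.trans (hq i)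
  set u : Fin k → ℝ := fun i => if r i ≤ Real.exp (-T) then -T else Real.log (r i) with hu
  have huB : ∀ i, |u i| ≤ B := by
    intro i
    rw [abs_le]
    simp only [hu]
    split_ifs with h
    · exact ⟨neg_le_neg (le_max_right _ _), by linarith⟩
    · have hlt := not_le.1 h
      have hri := (Real.exp_pos _).trans hlt
      refine ⟨?_, (Real.log_le_log hri (hrL i)).trans (le_max_left _ _)⟩
      have : -T ≤ Real.log (r i) := (Real.le_log_iff_exp_le hri).2 hlt.le
      have := le_max_right (Real.log L) T
      linarith
  have hru : ∀ i, r i ^ s ≤ Real.exp (s * u i) := by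
    intro i
    have : r i ≤ Real.exp (u i) := by
      simp only [hu]
      split_ifs with h
      · exact h
      · rw [Real.exp_log ((Real.exp_pos _).trans (not_le.1 h))]
    calc r i ^ s ≤ Real.exp (u i) ^ s := Real.rpow_le_rpow (hr i) this hs0.le
      _ = Real.exp (s * u i) := by rw [← Real.exp_mul, mul_comm]
  have hexp : ∀ i, Real.exp (s * u i) ≤ 1 + s * u i + s ^ 2 * B ^ 2 := by
    intro i
    have habs : |s * u i| ≤ s * B := by
      rw [abs_mul, abs_of_pos hs0]
      exact mul_le_mul_of_nonneg_left (huB i) hs0.le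
    have h1 := (abs_le.1 (Real.abs_exp_sub_one_sub_id_le (habs.trans hsB))).2
    have h2 : (s * u i) ^ 2 ≤ (s * B) ^ 2 := sq_le_sq' (neg_le_of_abs_le habs) (le_of_abs_le habs)
    rw [mul_pow s B] at h2
    linarith
  calc ∑ i, q i * r i ^ s ≤ ∑ i, q i * (1 + s * u i + s ^ 2 * B ^ 2) :=
        Finset.sum_le_sum fun i _ =>
          mul_le_mul_of_nonneg_left ((hru i).trans (hexp i)) (hq0 i)
    _ = (∑ i, q i) * (1 + s ^ 2 * B ^ 2) + s * ∑ i, q i * u i := by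
        rw [Finset.sum_mul, Finset.mul_sum, ← Finset.sum_add_distrib]
        exact Finset.sum_congr rfl fun i _ => by ring
    _ ≤ 1 - s * b / 2 := by
        rw [hq1]
        have h1 : s * ∑ i, q i * u i ≤ s * (-b) := mul_le_mul_of_nonneg_left hmean hs0.le
        have h2 : s * (s * (2 * B ^ 2)) ≤ s * b := mul_le_mul_of_nonneg_left hsb hs0.le
        nlinarith

variable {X : Type*} [MetricSpace X]

/-- A system contracting on average contracts the distance `d ^ s` in the mean, for small `s`. -/
theorem ContractingOnAverage.exists_sum_mul_edist_rpow_le {k : ℕ} {h : Fin k → X → X}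
    {p : Fin k → X → ℝ} (hcoa : ContractingOnAverage h p) (hp : IsProbabilityVectorField p)
    (hpos : BoundedAwayFromZero p) (hLip : ∀ i, ∃ K : ℝ≥0, LipschitzWith K (h i)) :
    ∃ (s : ℝ) (ρ : ℝ≥0∞), 0 < s ∧ s ≤ 1 ∧ ρ < 1 ∧ ∀ x y,
      ∑ i, ENNReal.ofReal (p i x) * edist (h i x) (h i y) ^ s ≤ ρ * edist x y ^ s := by
  obtain ⟨c, hc, hcp⟩ := hpos
  obtain ⟨b, hb, hcon⟩ := hcoa
  choose K hK using hLip
  set L : ℝ := 1 + ∑ i, (K i : ℝ) with hL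
  have hsum0 : 0 ≤ ∑ i, (K i : ℝ) := Finset.sum_nonneg fun i _ => (K i).2
  obtain ⟨s, ρ, hs0, hs1, hρ, hmain⟩ := exists_sum_mul_rpow_le (c := c) hc hb
    (show 1 ≤ L by linarith)
  refine ⟨s, ENNReal.ofReal ρ, hs0, hs1, ENNReal.ofReal_lt_one.2 hρ, fun x y => ?_⟩
  rcases eq_or_ne x y with rfl | hxy
  · simp [hs0]
  have hd : 0 < dist x y := dist_pos.2 hxy
  have key := hmain k (fun i => p i x) (fun i => dist (h i x) (h i y) / dist x y)
    (fun i => hcp i x) (hp x).2 (fun i => by positivity) (fun i => by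
      rw [div_le_iff₀ hd]
      refine ((hK i).dist_le_mul x y).trans (mul_le_mul_of_nonneg_right ?_ hd.le)
      have := Finset.single_le_sum (f := fun i => (K i : ℝ)) (fun i _ => (K i).2)
        (Finset.mem_univ i)
      linarith) (hcon x y hxy)
  have hreal : ∑ i, p i x * dist (h i x) (h i y) ^ s ≤ ρ * dist x y ^ s := by
    calc ∑ i, p i x * dist (h i x) (h i y) ^ s
        = (∑ i, p i x * (dist (h i x) (h i y) / dist x y) ^ s) * dist x y ^ s := by
          rw [Finset.sum_mul]
          refine Finset.sum_congr rfl fun i _ => ?_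
          rw [mul_assoc, ← Real.mul_rpow (by positivity) hd.le, div_mul_cancel₀ _ hd.ne']
      _ ≤ ρ * dist x y ^ s := mul_le_mul_of_nonneg_right key (by positivity)
  have hterm : ∀ i, ENNReal.ofReal (p i x) * edist (h i x) (h i y) ^ s
      = ENNReal.ofReal (p i x * dist (h i x) (h i y) ^ s) := fun i => by
    rw [edist_dist, ENNReal.ofReal_rpow_of_nonneg dist_nonneg hs0.le,
      ENNReal.ofReal_mul ((hp x).1 i)]
  rw [Finset.sum_congr rfl fun i _ => hterm i, ← ENNReal.ofReal_sum_of_nonneg, edist_dist,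
    ENNReal.ofReal_rpow_of_nonneg dist_nonneg hs0.le, ← ENNReal.ofReal_mul' (by positivity)]
  · exact ENNReal.ofReal_le_ofReal hreal
  · exact fun i _ => mul_nonneg ((hp x).1 i) (by positivity)

end Contraction

/-! ### Words and forward compositions -/

section Words

variable {X : Type*} {k : ℕ}

/-- The sequence `i ω₁ ω₂ …`. -/
def prepend (i : Fin k) (ω : ℕ → Fin k) : ℕ → Fin k
  | 0 => i
  | n + 1 => ω n

theorem measurable_prepend (i : Fin k) : Measurable (prepend i) := by
  refine measurable_pi_lambda _ fun n => ?_
  cases n with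
  | zero => exact measurable_const
  | succ n => exact measurable_pi_apply n

theorem measurable_shift : Measurable (shift : (ℕ → Fin k) → ℕ → Fin k) :=
  measurable_pi_lambda _ fun n => measurable_pi_apply (n + 1)

theorem shift_prepend (i : Fin k) (ω : ℕ → Fin k) : shift (prepend i ω) = ω := rfl

/-- The definition peels off the last symbol; inductions along the random walk need the first. -/
theorem forwardIter_succ (h : Fin k → X → X) (ω : ℕ → Fin k) (n : ℕ) (x : X) :
    forwardIter h ω (n + 1) x = forwardIter h (shift ω) n (h (ω 0) x) := by
  induction n with
  | zero => rfl
  | succ n ih =>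
    change h (ω (n + 1)) (forwardIter h ω (n + 1) x) = _
    rw [ih]
    rfl

theorem forwardIter_prepend (h : Fin k → X → X) (i : Fin k) (ω : ℕ → Fin k) (n : ℕ) (x : X) :
    forwardIter h (prepend i ω) (n + 1) x = forwardIter h ω n (h i x) :=
  forwardIter_succ h _ n x

theorem forwardIter_congr (h : Fin k → X → X) {ω η : ℕ → Fin k} {n : ℕ}
    (hωη : ∀ i < n, ω i = η i) : forwardIter h ω n = forwardIter h η n := by
  induction n with
  | zero => rfl
  | succ n ih =>
    simp only [forwardIter]
    rw [ih fun i hi => hωη i (hi.trans n.lt_succ_self), hωη n n.lt_succ_self]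

theorem wordProb_succ (h : Fin k → X → X) (p : Fin k → X → ℝ) (ω : ℕ → Fin k) (n : ℕ) (x : X) :
    wordProb h p ω (n + 1) x = p (ω 0) x * wordProb h p (shift ω) n (h (ω 0) x) := by
  rw [wordProb, Finset.prod_range_succ', mul_comm]
  congr 1
  exact Finset.prod_congr rfl fun i _ => by rw [forwardIter_succ]; rfl

variable [MeasurableSpace X]

theorem measurable_forwardIter {h : Fin k → X → X} (hh : ∀ i, Measurable (h i)) (n : ℕ) (x : X) :
    Measurable fun ω : ℕ → Fin k => forwardIter h ω n x := by
  induction n with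
  | zero => exact measurable_const
  | succ n ih =>
    have hu : Measurable fun z : Fin k × X => h z.1 z.2 := measurable_from_prod_countable_right hh
    exact hu.comp ((measurable_pi_apply n).prodMk ih)

end Words

/-! ### The Markov operator and integrability of Lyapunov functions -/

section MarkovOperator

variable {X : Type*} {k : ℕ}

/-- The Markov operator `g ↦ ∑ i, p_i · (g ∘ h_i)` of the system. -/
noncomputable def markovOp (h : Fin k → X → X) (p : Fin k → X → ℝ) (g : X → ℝ≥0∞) (x : X) :
    ℝ≥0∞ :=
  ∑ i, ENNReal.ofReal (p i x) * g (h i x)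

variable {h : Fin k → X → X} {p : Fin k → X → ℝ}

theorem IsProbabilityVectorField.sum_ofReal (hp : IsProbabilityVectorField p) (x : X) :
    ∑ i, ENNReal.ofReal (p i x) = 1 := by
  rw [← ENNReal.ofReal_sum_of_nonneg fun i _ => (hp x).1 i, (hp x).2, ENNReal.ofReal_one]

theorem IsProbabilityVectorField.ofReal_le_one (hp : IsProbabilityVectorField p) (i : Fin k)
    (x : X) : ENNReal.ofReal (p i x) ≤ 1 := by
  rw [← hp.sum_ofReal x]
  exact Finset.single_le_sum (f := fun i => ENNReal.ofReal (p i x)) (fun _ _ => zero_le)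
    (Finset.mem_univ i)

theorem markovOp_mono {f g : X → ℝ≥0∞} (hfg : ∀ x, f x ≤ g x) (x : X) :
    markovOp h p f x ≤ markovOp h p g x :=
  Finset.sum_le_sum fun _ _ => mul_le_mul_right (hfg _) _

theorem markovOp_min_const_le (hp : IsProbabilityVectorField p) (g : X → ℝ≥0∞) (N : ℝ≥0∞) (x : X) :
    markovOp h p (fun y => min (g y) N) x ≤ min (markovOp h p g x) N := by
  refine le_min (markovOp_mono (fun y => min_le_left _ _) x) ?_
  calc markovOp h p (fun y => min (g y) N) x ≤ ∑ i, ENNReal.ofReal (p i x) * N :=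
        Finset.sum_le_sum fun _ _ => mul_le_mul_right (min_le_right _ _) _
    _ = N := by rw [← Finset.sum_mul, hp.sum_ofReal, one_mul]

theorem markovOp_affine (hp : IsProbabilityVectorField p) (g : X → ℝ≥0∞) (a c : ℝ≥0∞) (x : X) :
    markovOp h p (fun y => a * g y + c) x = a * markovOp h p g x + c := by
  simp only [markovOp, mul_add, Finset.sum_add_distrib, ← Finset.sum_mul, hp.sum_ofReal, one_mul,
    Finset.mul_sum]
  congr 1
  exact Finset.sum_congr rfl fun i _ => by ring

variable [MeasurableSpace X]

theorem measurable_markovOp (hh : ∀ i, Measurable (h i)) (hpm : ∀ i, Measurable (p i))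
    {g : X → ℝ≥0∞} (hg : Measurable g) : Measurable (markovOp h p g) :=
  Finset.measurable_fun_sum _ fun i _ => (hpm i).ennreal_ofReal.mul (hg.comp (hh i))

theorem measurable_markovOp_iterate (hh : ∀ i, Measurable (h i)) (hpm : ∀ i, Measurable (p i))
    {g : X → ℝ≥0∞} (hg : Measurable g) (n : ℕ) : Measurable ((markovOp h p)^[n] g) := by
  induction n with
  | zero => exact hg
  | succ n ih =>
    rw [Function.iterate_succ_apply']
    exact measurable_markovOp hh hpm ih

theorem IsInvariantMeasure.lintegral_markovOp {ν : Measure X} (hν : IsInvariantMeasure h p ν)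
    (hh : ∀ i, Measurable (h i)) (hpm : ∀ i, Measurable (p i))
    {g : X → ℝ≥0∞} (hg : Measurable g) : ∫⁻ x, markovOp h p g x ∂ν = ∫⁻ x, g x ∂ν := by
  conv_rhs => rw [hν.eq_transfer]
  rw [transfer, lintegral_finsetSum_measure]
  simp only [markovOp]
  rw [lintegral_finsetSum (f := fun i x => ENNReal.ofReal (p i x) * g (h i x)) _
    fun i _ => (hpm i).ennreal_ofReal.mul (hg.comp (hh i))]
  refine Finset.sum_congr rfl fun i _ => ?_
  rw [lintegral_map hg (hh i)]
  exact (lintegral_withDensity_eq_lintegral_mul ν (hpm i).ennreal_ofReal (hg.comp (hh i))).symm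

theorem IsInvariantMeasure.lintegral_markovOp_iterate {ν : Measure X}
    (hν : IsInvariantMeasure h p ν) (hh : ∀ i, Measurable (h i)) (hpm : ∀ i, Measurable (p i))
    {g : X → ℝ≥0∞} (hg : Measurable g) (n : ℕ) :
    ∫⁻ x, (markovOp h p)^[n] g x ∂ν = ∫⁻ x, g x ∂ν := by
  induction n with
  | zero => rfl
  | succ n ih =>
    rw [Function.iterate_succ_apply', hν.lintegral_markovOp hh hpm
      (measurable_markovOp_iterate hh hpm hg n), ih]

/-- A Lyapunov function of the system is integrable for every invariant probability measure. -/
theorem IsInvariantMeasure.lintegral_lt_top_of_drift {ν : Measure X}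
    (hν : IsInvariantMeasure h p ν) (hp : IsProbabilityVectorField p)
    (hh : ∀ i, Measurable (h i)) (hpm : ∀ i, Measurable (p i)) {V : X → ℝ≥0∞} (hV : Measurable V)
    (hV_top : ∀ x, V x ≠ ⊤) {ρ C : ℝ≥0∞} (hρ : ρ < 1) (hC : C ≠ ⊤)
    (hdrift : ∀ x, markovOp h p V x ≤ ρ * V x + C) : ∫⁻ x, V x ∂ν < ⊤ := by
  have := hν.isProbabilityMeasure
  set D : ℝ≥0∞ := ∑' n, ρ ^ n * C with hD
  have hD_top : D ≠ ⊤ := by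
    rw [hD, ENNReal.tsum_mul_right, ENNReal.tsum_geometric]
    exact ENNReal.mul_ne_top (ENNReal.inv_ne_top.2 (tsub_pos_of_lt hρ).ne') hC
  -- The integral of `V` might be infinite, so the drift is iterated under a cap `N`, which the
  -- Markov operator respects; then `n → ∞`, and only afterwards `N → ∞`.
  have hstep : ∀ (N : ℝ≥0∞) (n : ℕ), ∫⁻ x, min (V x) N ∂ν ≤
      ∫⁻ x, min (ρ ^ n * V x + ∑ i ∈ Finset.range n, ρ ^ i * C) N ∂ν := by
    intro N n
    induction n with
    | zero => simp
    | succ n ih =>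
      refine ih.trans ?_
      rw [← hν.lintegral_markovOp hh hpm (((hV.const_mul _).add_const _).min measurable_const)]
      refine lintegral_mono fun x => (markovOp_min_const_le hp _ N x).trans ?_
      refine min_le_min_right _ ?_
      rw [markovOp_affine hp, Finset.sum_range_succ, pow_succ]
      calc ρ ^ n * markovOp h p V x + ∑ i ∈ Finset.range n, ρ ^ i * C
          ≤ ρ ^ n * (ρ * V x + C) + ∑ i ∈ Finset.range n, ρ ^ i * C := by gcongr; exact hdrift x
        _ = ρ ^ n * ρ * V x + (∑ i ∈ Finset.range n, ρ ^ i * C + ρ ^ n * C) := by ring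
  have hbound : ∀ N : ℕ, ∫⁻ x, min (V x) N ∂ν ≤ D := by
    intro N
    have hlim : Tendsto (fun n : ℕ => ∫⁻ x, min (ρ ^ n * V x + D) N ∂ν) atTop
        (𝓝 (∫⁻ _, min D N ∂ν)) := by
      refine tendsto_lintegral_of_dominated_convergence (fun _ => (N : ℝ≥0∞))
        (fun n => ((hV.const_mul _).add_const _).min measurable_const)
        (fun n => Eventually.of_forall fun x => min_le_right _ _) (by simp) ?_
      refine Eventually.of_forall fun x => ?_
      have h0 : Tendsto (fun n : ℕ => ρ ^ n * V x) atTop (𝓝 0) := by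
        have := ENNReal.Tendsto.mul_const (b := V x)
          (ENNReal.tendsto_pow_atTop_nhds_zero_of_lt_one hρ) (Or.inr (hV_top x))
        rwa [zero_mul] at this
      have h1 := (h0.add_const D).min (tendsto_const_nhds (x := (N : ℝ≥0∞)))
      rwa [zero_add] at h1
    have hle : ∫⁻ x, min (V x) N ∂ν ≤ ∫⁻ _, min D N ∂ν :=
      ge_of_tendsto' hlim fun n => (hstep N n).trans <| lintegral_mono fun x => by
        gcongr
        exact ENNReal.sum_le_tsum _
    refine hle.trans ?_
    simp
  have hmono : ∫⁻ x, V x ∂ν = ⨆ N : ℕ, ∫⁻ x, min (V x) N ∂ν := by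
    rw [← lintegral_iSup (fun N => hV.min measurable_const)
      (fun a b hab x => min_le_min_left _ (by exact_mod_cast hab))]
    refine lintegral_congr fun x => le_antisymm ?_ (iSup_le fun N => min_le_left _ _)
    obtain ⟨N, hN⟩ := ENNReal.exists_nat_gt (hV_top x)
    exact le_iSup_of_le N (le_min le_rfl hN.le)
  rw [hmono]
  exact (iSup_le hbound).trans_lt hD_top.lt_top

end MarkovOperator

/-! ### Laws of finite random words -/

section Walk

variable {X : Type*} {k : ℕ}

/-- The law of the first `n` symbols used by the random orbit of `x`, followed by the
constant sequence `i₀`. -/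
noncomputable def walk (h : Fin k → X → X) (p : Fin k → X → ℝ) (i₀ : Fin k) :
    ℕ → X → Measure (ℕ → Fin k)
  | 0, _ => Measure.dirac fun _ => i₀
  | n + 1, x => ∑ i, ENNReal.ofReal (p i x) • (walk h p i₀ n (h i x)).map (prepend i)

variable {h : Fin k → X → X} {p : Fin k → X → ℝ} {i₀ : Fin k}

theorem lintegral_walk_succ {F : (ℕ → Fin k) → ℝ≥0∞} (hF : Measurable F) (n : ℕ) (x : X) :
    ∫⁻ ω, F ω ∂walk h p i₀ (n + 1) x
      = ∑ i, ENNReal.ofReal (p i x) * ∫⁻ ω, F (prepend i ω) ∂walk h p i₀ n (h i x) := by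
  rw [walk, lintegral_finsetSum_measure]
  refine Finset.sum_congr rfl fun i _ => ?_
  rw [lintegral_smul_measure, lintegral_map hF (measurable_prepend i), smul_eq_mul]

theorem walk_succ_apply {A : Set (ℕ → Fin k)} (hA : MeasurableSet A) (n : ℕ) (x : X) :
    walk h p i₀ (n + 1) x A
      = ∑ i, ENNReal.ofReal (p i x) * walk h p i₀ n (h i x) (prepend i ⁻¹' A) := by
  rw [walk, Measure.finsetSum_apply]
  refine Finset.sum_congr rfl fun i _ => ?_
  rw [Measure.smul_apply, Measure.map_apply (measurable_prepend i) hA, smul_eq_mul]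

theorem isProbabilityMeasure_walk (hp : IsProbabilityVectorField p) (n : ℕ) (x : X) :
    IsProbabilityMeasure (walk h p i₀ n x) := by
  induction n generalizing x with
  | zero => rw [walk]; infer_instance
  | succ n ih =>
    refine ⟨?_⟩
    rw [walk_succ_apply MeasurableSet.univ, ← hp.sum_ofReal x]
    refine Finset.sum_congr rfl fun i _ => ?_
    have := ih (h i x)
    rw [Set.preimage_univ, measure_univ, mul_one]

theorem measurableSet_window (ω : ℕ → Fin k) (l j : ℕ) :
    MeasurableSet {η : ℕ → Fin k | ∀ i < j, η (l + i) = ω i} := by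
  simp only [Set.ofPred_forall]
  exact MeasurableSet.iInter fun i => MeasurableSet.iInter fun _ =>
    measurableSet_eq_fun (measurable_pi_apply (l + i)) measurable_const

theorem measurableSet_cylinder (ω : ℕ → Fin k) (j : ℕ) : MeasurableSet (cylinder ω j) := by
  simpa [cylinder] using measurableSet_window ω 0 j

theorem walk_cylinder (hp : IsProbabilityVectorField p) {j n : ℕ} (hj : j ≤ n) (ω : ℕ → Fin k)
    (x : X) : walk h p i₀ n x (cylinder ω j) = ENNReal.ofReal (wordProb h p ω j x) := by
  induction n generalizing j ω x with
  | zero =>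
    obtain rfl : j = 0 := by omega
    simp [cylinder, wordProb, walk]
  | succ n ih =>
    cases j with
    | zero =>
      have := isProbabilityMeasure_walk (h := h) (i₀ := i₀) hp (n + 1) x
      simp [cylinder, wordProb]
    | succ j =>
      rw [walk_succ_apply (measurableSet_cylinder _ _), Finset.sum_eq_single (ω 0)]
      · have : prepend (ω 0) ⁻¹' cylinder ω (j + 1) = cylinder (shift ω) j := by
          ext η
          refine ⟨fun hη i hi => hη (i + 1) (by omega), fun hη i hi => ?_⟩
          cases i with
          | zero => rfl
          | succ i => exact hη i (by omega)
        rw [this, ih (by omega), wordProb_succ, ENNReal.ofReal_mul ((hp x).1 _)]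
      · intro i _ hi
        have : prepend i ⁻¹' cylinder ω (j + 1) = ∅ := by
          ext η
          simp only [Set.mem_preimage, Set.mem_empty_iff_false, iff_false]
          exact fun hη => hi (hη 0 (by omega))
        rw [this, measure_empty, mul_zero]
      · simp

theorem lintegral_walk_comp_forwardIter [MeasurableSpace X] (hh : ∀ i, Measurable (h i))
    {f : X → ℝ≥0∞} (hf : Measurable f) (n : ℕ) (x : X) :
    ∫⁻ ω, f (forwardIter h ω n x) ∂walk h p i₀ n x = (markovOp h p)^[n] f x := by
  induction n generalizing x with
  | zero => simp [walk, forwardIter]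
  | succ n ih =>
    rw [lintegral_walk_succ (F := fun ω => f (forwardIter h ω (n + 1) x))
      (hf.comp (measurable_forwardIter hh _ _)),
      Function.iterate_succ_apply', markovOp]
    simp only [forwardIter_prepend, ih]

variable [MeasurableSpace X]

theorem measurable_walk (hh : ∀ i, Measurable (h i)) (hpm : ∀ i, Measurable (p i)) (n : ℕ) :
    Measurable (walk h p i₀ n) := by
  refine Measure.measurable_of_measurable_coe _ fun A hA => ?_
  induction n generalizing A with
  | zero => exact measurable_const
  | succ n ih =>
    simp only [walk_succ_apply hA]
    exact Finset.measurable_fun_sum _ fun i _ => (hpm i).ennreal_ofReal.mul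
      ((ih _ (measurable_prepend i hA)).comp (hh i))

/-- Stationarity: moving the window one step later applies the Markov operator to its probability,
and integration against `ν` does not see that operator. -/
theorem IsInvariantMeasure.lintegral_walk_window {ν : Measure X} (hν : IsInvariantMeasure h p ν)
    (hp : IsProbabilityVectorField p) (hh : ∀ i, Measurable (h i)) (hpm : ∀ i, Measurable (p i))
    {l j n : ℕ} (hlj : l + j ≤ n) (ω : ℕ → Fin k) :
    ∫⁻ x, walk h p i₀ n x {η | ∀ i < j, η (l + i) = ω i} ∂ν
      = ∫⁻ x, ENNReal.ofReal (wordProb h p ω j x) ∂ν := by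
  induction l generalizing n with
  | zero =>
    refine lintegral_congr fun x => ?_
    rw [← walk_cylinder (i₀ := i₀) hp (show j ≤ n by omega)]
    simp [cylinder]
  | succ l ih =>
    cases n with
    | zero => omega
    | succ n =>
      rw [← ih (show l + j ≤ n by omega), ← hν.lintegral_markovOp hh hpm
        (g := fun x => walk h p i₀ n x {η | ∀ i < j, η (l + i) = ω i}) ((Measure.measurable_coe (measurableSet_window ω l j)).comp (measurable_walk hh hpm n))]
      refine lintegral_congr fun x => ?_
      rw [walk_succ_apply (measurableSet_window _ _ _), markovOp]
      refine Finset.sum_congr rfl fun i _ => ?_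
      congr 2
      ext η
      simp only [Set.mem_preimage, Set.mem_ofPred_eq, Nat.succ_add, prepend]

end Walk

/-! ### Moment bounds along the random walk -/

section Moments

variable {X : Type*} [MetricSpace X] {k : ℕ} {h : Fin k → X → X}
  {p : Fin k → X → ℝ} {i₀ : Fin k} {s : ℝ} {ρ : ℝ≥0∞}

theorem edist_rpow_triangle (hs0 : 0 ≤ s) (hs1 : s ≤ 1) (x y z : X) :
    edist x z ^ s ≤ edist x y ^ s + edist y z ^ s :=
  (ENNReal.rpow_le_rpow (edist_triangle x y z) hs0).trans
    (ENNReal.rpow_add_le_add_rpow _ _ hs0 hs1)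

theorem markovOp_edist_rpow_le (hp : IsProbabilityVectorField p) (hs0 : 0 ≤ s) (hs1 : s ≤ 1)
    (hcon : ∀ x y, ∑ i, ENNReal.ofReal (p i x) * edist (h i x) (h i y) ^ s ≤ ρ * edist x y ^ s)
    (x₀ x : X) : markovOp h p (fun y => edist y x₀ ^ s) x
      ≤ ρ * edist x x₀ ^ s + ∑ i, edist (h i x₀) x₀ ^ s := by
  calc markovOp h p (fun y => edist y x₀ ^ s) x
      ≤ ∑ i, (ENNReal.ofReal (p i x) * edist (h i x) (h i x₀) ^ s + edist (h i x₀) x₀ ^ s) := by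
        refine Finset.sum_le_sum fun i _ => ?_
        refine (mul_le_mul_right (edist_rpow_triangle hs0 hs1 _ (h i x₀) _) _).trans ?_
        rw [mul_add]
        gcongr
        exact mul_le_of_le_one_left zero_le (hp.ofReal_le_one i x)
    _ ≤ _ := by
        rw [Finset.sum_add_distrib]
        gcongr
        exact hcon x x₀

variable [MeasurableSpace X] [BorelSpace X] [SecondCountableTopology X]

theorem lintegral_walk_edist_forwardIter_le (hh : ∀ i, Measurable (h i))
    (hcon : ∀ x y, ∑ i, ENNReal.ofReal (p i x) * edist (h i x) (h i y) ^ s ≤ ρ * edist x y ^ s)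
    (n : ℕ) (x y : X) :
    ∫⁻ ω, edist (forwardIter h ω n x) (forwardIter h ω n y) ^ s ∂walk h p i₀ n x
      ≤ ρ ^ n * edist x y ^ s := by
  induction n generalizing x y with
  | zero => simp [walk, forwardIter]
  | succ n ih =>
    rw [lintegral_walk_succ (((measurable_forwardIter hh _ _).edist
      (measurable_forwardIter hh _ _)).pow_const s)]
    simp only [forwardIter_prepend]
    calc _ ≤ ∑ i, ENNReal.ofReal (p i x) * (ρ ^ n * edist (h i x) (h i y) ^ s) :=
          Finset.sum_le_sum fun i _ => mul_le_mul_right (ih _ _) _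
      _ = ρ ^ n * ∑ i, ENNReal.ofReal (p i x) * edist (h i x) (h i y) ^ s := by
          rw [Finset.mul_sum]
          exact Finset.sum_congr rfl fun i _ => by ring
      _ ≤ ρ ^ n * (ρ * edist x y ^ s) := mul_le_mul_right (hcon x y) _
      _ = ρ ^ (n + 1) * edist x y ^ s := by ring

/-- Contraction is available only towards the orbit that draws the symbols. Both points are
therefore compared with the orbit of `x`, which after one step is at `h i x`, while they start from
`x₀` and `h i x₀`. -/
theorem lintegral_walk_edist_shift_le (hp : IsProbabilityVectorField p) (hs0 : 0 ≤ s)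
    (hs1 : s ≤ 1) (hρ : ρ ≤ 1) (hh : ∀ i, Measurable (h i))
    (hcon : ∀ x y, ∑ i, ENNReal.ofReal (p i x) * edist (h i x) (h i y) ^ s ≤ ρ * edist x y ^ s)
    (x₀ : X) (n : ℕ) (x : X) :
    ∫⁻ ω, edist (forwardIter h (shift ω) n x₀) (forwardIter h ω (n + 1) x₀) ^ s
        ∂walk h p i₀ (n + 1) x
      ≤ ρ ^ n * (2 * edist x x₀ ^ s + ∑ i, edist (h i x₀) x₀ ^ s) := by
  rw [lintegral_walk_succ (F := fun ω => edist (forwardIter h (shift ω) n x₀)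
    (forwardIter h ω (n + 1) x₀) ^ s) ((((measurable_forwardIter hh _ _).comp
      measurable_shift).edist (measurable_forwardIter hh _ _)).pow_const s)]
  simp only [forwardIter_prepend, shift_prepend]
  have hm : ∀ y z : X, Measurable fun ω : ℕ → Fin k =>
      edist (forwardIter h ω n y) (forwardIter h ω n z) ^ s := fun y z =>
    ((measurable_forwardIter hh _ _).edist (measurable_forwardIter hh _ _)).pow_const s
  calc _ ≤ ∑ i, ENNReal.ofReal (p i x) *
        (ρ ^ n * edist (h i x) x₀ ^ s + ρ ^ n * edist (h i x) (h i x₀) ^ s) := by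
        refine Finset.sum_le_sum fun i _ => mul_le_mul_right ?_ _
        calc _ ≤ ∫⁻ ω, (edist (forwardIter h ω n (h i x)) (forwardIter h ω n x₀) ^ s
              + edist (forwardIter h ω n (h i x)) (forwardIter h ω n (h i x₀)) ^ s)
                ∂walk h p i₀ n (h i x) := by
              refine lintegral_mono fun ω => ?_
              rw [edist_comm (forwardIter h ω n (h i x)) (forwardIter h ω n x₀)]
              exact edist_rpow_triangle hs0 hs1 _ _ _
          _ ≤ _ := by
              rw [lintegral_add_left (hm _ _)]
              exact add_le_add (lintegral_walk_edist_forwardIter_le hh hcon _ _ _)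
                (lintegral_walk_edist_forwardIter_le hh hcon _ _ _)
    _ = ρ ^ n * (markovOp h p (fun y => edist y x₀ ^ s) x +
          ∑ i, ENNReal.ofReal (p i x) * edist (h i x) (h i x₀) ^ s) := by
        rw [markovOp, ← Finset.sum_add_distrib, Finset.mul_sum]
        exact Finset.sum_congr rfl fun i _ => by ring
    _ ≤ ρ ^ n * ((ρ * edist x x₀ ^ s + ∑ i, edist (h i x₀) x₀ ^ s) + ρ * edist x x₀ ^ s) := by
        gcongr
        · exact markovOp_edist_rpow_le hp hs0 hs1 hcon x₀ x
        · exact hcon x x₀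
    _ ≤ ρ ^ n * ((1 * edist x x₀ ^ s + ∑ i, edist (h i x₀) x₀ ^ s) + 1 * edist x x₀ ^ s) := by
        gcongr
    _ = _ := by ring

end Moments

/-! ### Finite windows of two-sided sequences -/

section Windows

variable {k : ℕ}

/-- The sequence `ω_a ω_{a+1} …` read off a two-sided sequence. -/
def readFrom (a : ℤ) (ω : ℤ → Fin k) : ℕ → Fin k := fun i => ω (a + i)

theorem measurable_readFrom (a : ℤ) : Measurable (readFrom a : (ℤ → Fin k) → ℕ → Fin k) :=
  measurable_pi_lambda _ fun i => measurable_pi_apply (a + i)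

theorem measurable_shiftZ : Measurable (shiftZ : (ℤ → Fin k) → ℤ → Fin k) :=
  measurable_pi_lambda _ fun i => measurable_pi_apply (i + 1)

theorem measurable_past : Measurable (past : (ℤ → Fin k) → ℕ → Fin k) :=
  measurable_pi_lambda _ fun i => measurable_pi_apply (-(i : ℤ))

/-- A finite word, continued by the constant sequence `i₀`. -/
def extendWord (i₀ : Fin k) {n : ℕ} (w : Fin n → Fin k) : ℕ → Fin k :=
  fun i => if hi : i < n then w ⟨i, hi⟩ else i₀

theorem extendWord_apply (i₀ : Fin k) {n : ℕ} (w : Fin n → Fin k) (i : Fin n) :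
    extendWord i₀ w i = w i := by
  simp [extendWord]

theorem measurable_firstSymbols (n : ℕ) :
    Measurable fun (ω : ℕ → Fin k) (i : Fin n) => ω i :=
  measurable_pi_lambda _ fun i => measurable_pi_apply (i : ℕ)

theorem preimage_firstSymbols_singleton (i₀ : Fin k) {n : ℕ} (w : Fin n → Fin k) :
    (fun (ω : ℕ → Fin k) (i : Fin n) => ω i) ⁻¹' {w} = cylinder (extendWord i₀ w) n := by
  ext ω
  simp only [Set.mem_preimage, Set.mem_singleton_iff, funext_iff, cylinder, Set.mem_ofPred_eq]
  refine ⟨fun hω i hi => ?_, fun hω i => ?_⟩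
  · rw [← Fin.val_mk hi, extendWord_apply]
    exact hω ⟨i, hi⟩
  · rw [hω i i.2, extendWord_apply]

theorem map_firstSymbols_eq {μ μ' : Measure (ℕ → Fin k)} (i₀ : Fin k) {n : ℕ}
    (heq : ∀ ω, μ (cylinder ω n) = μ' (cylinder ω n)) :
    μ.map (fun (ω : ℕ → Fin k) (i : Fin n) => ω i)
      = μ'.map (fun (ω : ℕ → Fin k) (i : Fin n) => ω i) := by
  refine Measure.ext_of_singleton fun w => ?_
  rw [Measure.map_apply (measurable_firstSymbols n) (measurableSet_singleton w),
    Measure.map_apply (measurable_firstSymbols n) (measurableSet_singleton w),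
    preimage_firstSymbols_singleton i₀, heq]

theorem lintegral_eq_of_cylinder_eq {μ μ' : Measure (ℕ → Fin k)} (i₀ : Fin k) {n : ℕ}
    (heq : ∀ ω, μ (cylinder ω n) = μ' (cylinder ω n)) {F : (ℕ → Fin k) → ℝ≥0∞}
    (hF : ∀ ω η : ℕ → Fin k, (∀ i < n, ω i = η i) → F ω = F η) :
    ∫⁻ ω, F ω ∂μ = ∫⁻ ω, F ω ∂μ' := by
  -- `F` factors through a finite discrete space, so it is measurable without assumption.
  have hfac : F = fun ω => F (extendWord i₀ fun i : Fin n => ω i) := by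
    funext ω
    exact hF _ _ fun i hi => (extendWord_apply i₀ (fun i : Fin n => ω i) ⟨i, hi⟩).symm
  have hm : Measurable fun w : Fin n → Fin k => F (extendWord i₀ w) := .of_discrete
  have hmap := map_firstSymbols_eq i₀ heq
  rw [hfac]
  calc ∫⁻ ω : ℕ → Fin k, F (extendWord i₀ fun i : Fin n => ω i) ∂μ
      = ∫⁻ w, F (extendWord i₀ w) ∂μ.map (fun (ω : ℕ → Fin k) (i : Fin n) => ω i) :=
        (lintegral_map hm (measurable_firstSymbols n)).symm
    _ = _ := by rw [hmap, lintegral_map hm (measurable_firstSymbols n)]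

/-- A finite measure on two-sided sequences is determined by the masses of the sets of sequences
with prescribed symbols in an interval of indices. -/
theorem ext_of_map_readFrom_cylinder {μ μ' : Measure (ℤ → Fin k)} [IsFiniteMeasure μ]
    (i₀ : Fin k)
    (heq : ∀ (a : ℤ) (n : ℕ) ω, μ.map (readFrom a) (cylinder ω n)
      = μ'.map (readFrom a) (cylinder ω n)) : μ = μ' := by
  refine ext_of_generate_finite (measurableCylinders fun _ => Fin k)
    generateFrom_measurableCylinders.symm isPiSystem_measurableCylinders (fun A hA => ?_) ?_
  · obtain ⟨J, S, hS, rfl⟩ := (mem_measurableCylinders A).1 hA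
    -- The finite index set `J` fits into the window of length `2 * N` starting at `-N`.
    obtain ⟨N, hN⟩ : ∃ N : ℕ, ∀ j ∈ J, j.natAbs < N :=
      ⟨J.sup Int.natAbs + 1, fun j hj => Nat.lt_succ_of_le (Finset.le_sup (f := Int.natAbs) hj)⟩
    have hidx : ∀ j : J, ((j : ℤ) + N).toNat < 2 * N := fun j => by
      have := hN j j.2
      omega
    set S' : Set (Fin (2 * N) → Fin k) := {w | (fun j : J => w ⟨_, hidx j⟩) ∈ S} with hS'
    have hpre : MeasureTheory.cylinder J S = (readFrom (-(N : ℤ))) ⁻¹'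
        ((fun (ω : ℕ → Fin k) (i : Fin (2 * N)) => ω i) ⁻¹' S') := by
      ext ω
      simp only [mem_cylinder, Set.mem_preimage, hS', Set.mem_ofPred_eq, readFrom]
      refine iff_of_eq (congrArg (· ∈ S) (funext fun j => ?_))
      have := hN j j.2
      exact congrArg ω (by omega)
    have hS'm : MeasurableSet S' := .of_discrete
    rw [hpre, ← Measure.map_apply (measurable_readFrom _) (measurable_firstSymbols _ hS'm),
      ← Measure.map_apply (measurable_readFrom _) (measurable_firstSymbols _ hS'm),
      ← Measure.map_apply (measurable_firstSymbols _) hS'm,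
      ← Measure.map_apply (measurable_firstSymbols _) hS'm, map_firstSymbols_eq i₀ (heq _ _)]
  · have := heq 0 0 fun _ => i₀
    rwa [Measure.map_apply (measurable_readFrom _) (measurableSet_cylinder _ _),
      Measure.map_apply (measurable_readFrom _) (measurableSet_cylinder _ _),
      show cylinder (fun _ => i₀) 0 = Set.univ from Set.eq_univ_of_forall fun ω i hi => by omega,
      Set.preimage_univ] at this

theorem isClopen_preimage_readFrom_cylinder (a : ℤ) (ω : ℕ → Fin k) (n : ℕ) :
    IsClopen (readFrom a ⁻¹' cylinder ω n) := by
  have : readFrom a ⁻¹' cylinder ω n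
      = (fun (η : ℤ → Fin k) (i : Fin n) => η (a + i)) ⁻¹' {fun i : Fin n => ω i} := by
    ext η
    simp only [Set.mem_preimage, Set.mem_singleton_iff, funext_iff, cylinder, Set.mem_ofPred_eq]
    exact ⟨fun hη i => hη i i.2, fun hη i hi => hη ⟨i, hi⟩⟩
  rw [this]
  exact (isClopen_discrete _).preimage (by fun_prop)

end Windows

/-! ### The two-sided stationary measure -/

section TwoSided

variable {X : Type*} [MeasurableSpace X] {k : ℕ} {h : Fin k → X → X} {p : Fin k → X → ℝ}
  {ν : Measure X}

/-- The stationary process of symbols extends to negative times. -/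
theorem IsInvariantMeasure.exists_twoSided (hν : IsInvariantMeasure h p ν)
    (hp : IsProbabilityVectorField p) (hh : ∀ i, Measurable (h i)) (hpm : ∀ i, Measurable (p i))
    (i₀ : Fin k) : ∃ μ : Measure (ℤ → Fin k), IsProbabilityMeasure μ ∧
      ∀ a, IsForwardMeasure h p ν (μ.map (readFrom a)) := by
  have := hν.isProbabilityMeasure
  have hwalk : ∀ n, IsProbabilityMeasure (ν.bind (walk h p i₀ n)) := fun n => by
    refine ⟨?_⟩
    rw [Measure.bind_apply MeasurableSet.univ (measurable_walk hh hpm n).aemeasurable]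
    have := fun x => isProbabilityMeasure_walk (h := h) (i₀ := i₀) hp n x
    simp
  have hpad : ∀ N : ℕ, Measurable fun (ω : ℕ → Fin k) (z : ℤ) => ω (z + N).toNat := fun N =>
    measurable_pi_lambda _ fun z => measurable_pi_apply (z + N).toNat
  -- The `2 * N` random symbols occupy the times from `-N` to `N - 1`. Earlier times repeat the
  -- first symbol and later ones carry `i₀`; a fixed window eventually avoids both.
  let u : ℕ → ProbabilityMeasure (ℤ → Fin k) := fun N =>
    ⟨(ν.bind (walk h p i₀ (2 * N))).map fun (ω : ℕ → Fin k) (z : ℤ) => ω (z + N).toNat,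
      Measure.isProbabilityMeasure_map (hpad N).aemeasurable⟩
  have hu : ∀ (a : ℤ) (n : ℕ) (ω : ℕ → Fin k), ∀ᶠ N in atTop,
      (u N : Measure (ℤ → Fin k)) (readFrom a ⁻¹' cylinder ω n)
        = ∫⁻ x, ENNReal.ofReal (wordProb h p ω n x) ∂ν := by
    intro a n ω
    filter_upwards [eventually_ge_atTop (a.natAbs + n)] with N hN
    have hmeas := measurable_readFrom a (measurableSet_cylinder ω n)
    change (Measure.map _ _) _ = _
    rw [Measure.map_apply (hpad N) hmeas,
      Measure.bind_apply (hpad N hmeas) (measurable_walk hh hpm _).aemeasurable,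
      ← hν.lintegral_walk_window (i₀ := i₀) hp hh hpm (l := (a + N).toNat) (n := 2 * N) (by omega)]
    refine lintegral_congr fun x => congrArg _ ?_
    ext η
    simp only [Set.mem_preimage, cylinder, Set.mem_ofPred_eq, readFrom]
    refine forall₂_congr fun i _ => ?_
    rw [show (a + i + N).toNat = (a + N).toNat + i by omega]
  -- Probability measures on the compact sequence space form a compact space, so the ultrafilter
  -- limit exists. Cylinders are clopen, and their eventually constant masses pass to the limit.
  have hlim : Tendsto u (hyperfilter ℕ) (𝓝 ((hyperfilter ℕ).map u).lim) :=
    ((hyperfilter ℕ).map u).le_nhds_lim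
  set μ := ((hyperfilter ℕ).map u).lim
  refine ⟨μ, inferInstance, fun a => ⟨Measure.isProbabilityMeasure_map
    (measurable_readFrom a).aemeasurable, fun ω n => ?_⟩⟩
  rw [Measure.map_apply (measurable_readFrom a) (measurableSet_cylinder ω n)]
  have hfront : (μ : Measure (ℤ → Fin k)) (frontier (readFrom a ⁻¹' cylinder ω n)) = 0 := by
    rw [(isClopen_preimage_readFrom_cylinder a ω n).frontier_eq, measure_empty]
  refine tendsto_nhds_unique
    (ProbabilityMeasure.tendsto_measure_of_null_frontier_of_tendsto' hlim hfront) ?_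
  exact tendsto_const_nhds.congr' <|
    ((hu a n ω).filter_mono Nat.hyperfilter_le_atTop).mono fun N hN => hN.symm

theorem measurePreserving_shiftZ {μ : Measure (ℤ → Fin k)} [IsProbabilityMeasure μ] (i₀ : Fin k)
    (hμ : ∀ a, IsForwardMeasure h p ν (μ.map (readFrom a))) : MeasurePreserving shiftZ μ μ := by
  refine ⟨measurable_shiftZ, ?_⟩
  have := Measure.isProbabilityMeasure_map (μ := μ) measurable_shiftZ.aemeasurable
  refine ext_of_map_readFrom_cylinder i₀ fun a n ω => ?_
  rw [Measure.map_map (measurable_readFrom a) measurable_shiftZ]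
  have hcomp : readFrom a ∘ shiftZ = (readFrom (a + 1) : (ℤ → Fin k) → ℕ → Fin k) := by
    funext η i
    exact congrArg η (by ring)
  rw [hcomp, (hμ (a + 1)).apply_cylinder, (hμ a).apply_cylinder]

/-- Time reversal makes `shift` undo `shiftZ`: `shift ∘ past ∘ shiftZ = past`. -/
theorem measurePreserving_shift_map_past {μ : Measure (ℤ → Fin k)}
    (hμ : MeasurePreserving shiftZ μ μ) :
    MeasurePreserving shift (μ.map past) (μ.map past) := by
  refine ⟨measurable_shift, ?_⟩
  conv_lhs => rw [← hμ.map_eq]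
  rw [Measure.map_map measurable_past measurable_shiftZ,
    Measure.map_map measurable_shift (measurable_past.comp measurable_shiftZ)]
  congr 1
  funext η n
  exact congrArg η (by push_cast; ring)

/-- This restores the starting point `x`, invisible in the symbols, to which the moment bounds
refer. -/
theorem IsForwardMeasure.lintegral_eq {μp : Measure (ℕ → Fin k)} (hμp : IsForwardMeasure h p ν μp)
    (hp : IsProbabilityVectorField p) (hh : ∀ i, Measurable (h i)) (hpm : ∀ i, Measurable (p i))
    (i₀ : Fin k) {n : ℕ} {F : (ℕ → Fin k) → ℝ≥0∞} (hFm : Measurable F)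
    (hF : ∀ ω η : ℕ → Fin k, (∀ i < n, ω i = η i) → F ω = F η) :
    ∫⁻ ω, F ω ∂μp = ∫⁻ x, ∫⁻ ω, F ω ∂walk h p i₀ n x ∂ν := by
  rw [← Measure.lintegral_bind (measurable_walk hh hpm n).aemeasurable hFm.aemeasurable]
  refine lintegral_eq_of_cylinder_eq i₀ (fun ω => ?_) hF
  rw [hμp.apply_cylinder, Measure.bind_apply (measurableSet_cylinder ω n)
    (measurable_walk hh hpm n).aemeasurable]
  exact lintegral_congr fun x => (walk_cylinder hp le_rfl ω x).symm

end TwoSided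

/-! ### Backward compositions as forward compositions -/

section Reversal

variable {X : Type*} {k : ℕ}

theorem backwardIter_eq_forwardIter (h : Fin k → X → X) {ω η : ℕ → Fin k} {n : ℕ}
    (hη : ∀ i < n, η i = ω (n - 1 - i)) (x : X) :
    backwardIter h ω n x = forwardIter h η n x := by
  induction n generalizing η x with
  | zero => rfl
  | succ n ih =>
    rw [forwardIter_succ, hη 0 n.succ_pos, ← ih (η := shift η)]
    · rfl
    · intro i hi
      rw [shift, hη (i + 1) (by omega)]
      congr 1
      omega

theorem backwardIter_past_succ (h : Fin k → X → X) (ω : ℤ → Fin k) (n : ℕ) (x : X) :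
    backwardIter h (past ω) (n + 1) x = forwardIter h (readFrom (-(n : ℤ)) ω) (n + 1) x :=
  backwardIter_eq_forwardIter h (fun i hi => congrArg ω (by omega)) x

/-- The window starts at `1 - n`; writing it as a shifted window from `-n` makes the iterates `n`
and `n + 1` functions of the same sequence. -/
theorem backwardIter_past (h : Fin k → X → X) (ω : ℤ → Fin k) (n : ℕ) (x : X) :
    backwardIter h (past ω) n x = forwardIter h (shift (readFrom (-(n : ℤ)) ω)) n x :=
  backwardIter_eq_forwardIter h (fun i hi => congrArg ω (by push_cast; omega)) x

theorem measurable_backwardIter [MeasurableSpace X] {h : Fin k → X → X}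
    (hh : ∀ i, Measurable (h i)) (n : ℕ) (x : X) :
    Measurable fun ω : ℕ → Fin k => backwardIter h ω n x := by
  have : (fun ω : ℕ → Fin k => backwardIter h ω n x)
      = fun ω => forwardIter h (fun i => ω (n - 1 - i)) n x :=
    funext fun ω => backwardIter_eq_forwardIter h (fun i _ => rfl) x
  rw [this]
  exact (measurable_forwardIter hh n x).comp
    (measurable_pi_lambda _ fun i => measurable_pi_apply (n - 1 - i))

end Reversal

/-! ### Estimates with the power `s` of a distance -/

section Cauchy

variable {X : Type*} [PseudoEMetricSpace X]

theorem cauchySeq_of_tsum_edist_rpow_ne_top {f : ℕ → X} {s : ℝ} (hs0 : 0 < s) (hs1 : s ≤ 1)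
    (hsum : ∑' n, edist (f n) (f (n + 1)) ^ s ≠ ⊤) : CauchySeq f := by
  set M := ∑' n, edist (f n) (f (n + 1)) ^ s
  have hexp : 0 ≤ s⁻¹ - 1 := sub_nonneg.2 ((one_le_inv₀ hs0).2 hs1)
  -- Each `a ^ s` is at most the sum `M`, so `a = a ^ s * (a ^ s) ^ (1/s - 1) ≤ a ^ s * M ^ (1/s -
  -- 1)`.
  refine cauchySeq_of_edist_le_of_tsum_ne_top
    (fun n => edist (f n) (f (n + 1)) ^ s * M ^ (s⁻¹ - 1)) (fun n => ?_) ?_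
  · calc edist (f n) (f (n + 1)) = (edist (f n) (f (n + 1)) ^ s) ^ (1 + (s⁻¹ - 1)) := by
          rw [← ENNReal.rpow_mul, add_sub_cancel, mul_inv_cancel₀ hs0.ne', ENNReal.rpow_one]
      _ = edist (f n) (f (n + 1)) ^ s * (edist (f n) (f (n + 1)) ^ s) ^ (s⁻¹ - 1) := by
          rw [ENNReal.rpow_add_of_nonneg _ _ zero_le_one hexp, ENNReal.rpow_one]
      _ ≤ _ := by
          gcongr
          exact ENNReal.le_tsum n
  · rw [ENNReal.tsum_mul_right]
    exact ENNReal.mul_ne_top hsum (ENNReal.rpow_ne_top_of_nonneg hexp hsum)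

/-- Boundedness by `1` turns Lipschitz into Hölder continuity, because `min 1 t ≤ t ^ s`. -/
theorem coe_le_coe_add_rpow_edist {f : X → ℝ≥0} {K : ℝ≥0} (hf : LipschitzWith K f)
    (hf1 : ∀ x, f x ≤ 1) {s : ℝ} (hs0 : 0 ≤ s) (hs1 : s ≤ 1) (x y : X) :
    (f x : ℝ≥0∞) ≤ f y + (K : ℝ≥0∞) ^ s * edist x y ^ s := by
  rw [← ENNReal.mul_rpow_of_nonneg _ _ hs0]
  rcases le_total 1 ((K : ℝ≥0∞) * edist x y) with hle | hle
  · calc (f x : ℝ≥0∞) ≤ 1 := by exact_mod_cast hf1 x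
      _ ≤ ((K : ℝ≥0∞) * edist x y) ^ s := by
          simpa using ENNReal.rpow_le_rpow hle hs0
      _ ≤ _ := le_add_self
  · calc (f x : ℝ≥0∞) ≤ f y + edist (f x) (f y) := by
          rw [edist_nndist, NNReal.nndist_eq, ← ENNReal.coe_add, ENNReal.coe_le_coe]
          exact tsub_le_iff_left.1 (le_max_left _ _)
      _ ≤ f y + ((K : ℝ≥0∞) * edist x y) ^ (1 : ℝ) := by
          rw [ENNReal.rpow_one]
          gcongr
          exact hf x y
      _ ≤ _ := add_le_add_right (ENNReal.rpow_le_rpow_of_exponent_ge hle hs1) _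

end Cauchy

/-! ### Convergence of backward iterates and the law of the limit -/

section Coding

variable {X : Type*} [MetricSpace X] [MeasurableSpace X] [BorelSpace X] {k : ℕ} {h : Fin k → X → X} {p : Fin k → X → ℝ}
  {ν : Measure X} {μ : Measure (ℤ → Fin k)} {s : ℝ} {ρ : ℝ≥0∞}

/-- Thickened indicators are Lipschitz, bounded by `1`, and converge to the indicator of a closed
set; closed sets determine the measure. -/
theorem ext_of_lintegral_thickenedIndicator {ν ν' : Measure X} [IsProbabilityMeasure ν]
    [IsProbabilityMeasure ν']
    (heq : ∀ (f : BoundedContinuousFunction X ℝ≥0) (K : ℝ≥0), LipschitzWith K f →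
      (∀ x, f x ≤ 1) → ∫⁻ x, f x ∂ν = ∫⁻ x, f x ∂ν') : ν = ν' := by
  refine ext_of_generate_finite _ (BorelSpace.measurable_eq.trans borel_eq_generateFrom_isClosed)
    isPiSystem_isClosed (fun F hF => ?_) (by simp)
  have hδ : ∀ n : ℕ, (0 : ℝ) < 1 / ((n : ℝ) + 1) := fun n => Nat.one_div_pos_of_nat
  refine tendsto_nhds_unique (tendsto_lintegral_thickenedIndicator_of_isClosed ν hF hδ
    tendsto_one_div_add_atTop_nhds_zero_nat) ?_
  simp_rw [fun n => heq _ _ (lipschitzWith_thickenedIndicator (hδ n) F)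
    (thickenedIndicator_le_one (hδ n) F)]
  exact tendsto_lintegral_thickenedIndicator_of_isClosed ν' hF hδ
    tendsto_one_div_add_atTop_nhds_zero_nat

variable [SecondCountableTopology X]

theorem ae_cauchySeq_backwardIter (hp : IsProbabilityVectorField p) (hs0 : 0 < s) (hs1 : s ≤ 1)
    (hρ : ρ < 1) (hh : ∀ i, Measurable (h i)) (hpm : ∀ i, Measurable (p i))
    (hcon : ∀ x y, ∑ i, ENNReal.ofReal (p i x) * edist (h i x) (h i y) ^ s ≤ ρ * edist x y ^ s)
    (i₀ : Fin k) (x₀ : X) [IsProbabilityMeasure ν] (hmoment : ∫⁻ x, edist x x₀ ^ s ∂ν < ⊤)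
    (hμ : ∀ a, IsForwardMeasure h p ν (μ.map (readFrom a))) :
    ∀ᵐ ω ∂μ.map past, CauchySeq fun n => backwardIter h ω n x₀ := by
  set C := ∑ i, edist (h i x₀) x₀ ^ s with hC
  have hC_top : C ≠ ⊤ := ENNReal.sum_ne_top.2 fun i _ =>
    ENNReal.rpow_ne_top_of_nonneg hs0.le (edist_ne_top _ _)
  set A := ∫⁻ x, edist x x₀ ^ s ∂ν with hA
  have hVm : Measurable fun x : X => edist x x₀ ^ s :=
    (measurable_id.edist measurable_const).pow_const s
  have hm : ∀ n, Measurable fun ω : ℕ → Fin k =>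
      edist (backwardIter h ω n x₀) (backwardIter h ω (n + 1) x₀) ^ s := fun n =>
    ((measurable_backwardIter hh _ _).edist (measurable_backwardIter hh _ _)).pow_const s
  have hstep : ∀ n, ∫⁻ ω, edist (backwardIter h ω n x₀) (backwardIter h ω (n + 1) x₀) ^ s
      ∂μ.map past ≤ ρ ^ n * (2 * A + C) := by
    intro n
    set F : (ℕ → Fin k) → ℝ≥0∞ := fun ω =>
      edist (forwardIter h (shift ω) n x₀) (forwardIter h ω (n + 1) x₀) ^ s with hF
    have hFm : Measurable F := ((((measurable_forwardIter hh _ _).comp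
      measurable_shift).edist (measurable_forwardIter hh _ _)).pow_const s)
    rw [lintegral_map (hm n) measurable_past]
    simp only [backwardIter_past_succ, backwardIter_past]
    rw [← lintegral_map hFm (measurable_readFrom (-(n : ℤ))), (hμ _).lintegral_eq hp hh hpm i₀
      (n := n + 1) hFm fun ω η hωη => ?_]
    · calc _ ≤ ∫⁻ x, ρ ^ n * (2 * edist x x₀ ^ s + C) ∂ν := lintegral_mono fun x =>
            lintegral_walk_edist_shift_le hp hs0.le hs1 hρ.le hh hcon x₀ n x
        _ = ρ ^ n * (2 * A + C) := by
            rw [lintegral_const_mul _ ((hVm.const_mul _).add_const _),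
              lintegral_add_right _ measurable_const, lintegral_const_mul _ hVm,
              lintegral_const, measure_univ, mul_one]
    · simp only [hF]
      rw [forwardIter_congr h hωη, forwardIter_congr h (ω := shift ω) (η := shift η)
        fun i hi => hωη (i + 1) (by omega)]
  have hsum : ∫⁻ ω, ∑' n, edist (backwardIter h ω n x₀) (backwardIter h ω (n + 1) x₀) ^ s
      ∂μ.map past ≠ ⊤ := by
    rw [lintegral_tsum fun n => (hm n).aemeasurable]
    refine ne_top_of_le_ne_top ?_ (ENNReal.tsum_le_tsum hstep)
    rw [ENNReal.tsum_mul_right, ENNReal.tsum_geometric]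
    refine ENNReal.mul_ne_top (ENNReal.inv_ne_top.2 (tsub_pos_of_lt hρ).ne') ?_
    exact ENNReal.add_ne_top.2 ⟨ENNReal.mul_ne_top (by simp) hmoment.ne, hC_top⟩
  filter_upwards [ae_lt_top (Measurable.tsum hm) hsum] with ω hω
  exact cauchySeq_of_tsum_edist_rpow_ne_top hs0 hs1 hω.ne

/-- Both sides are averages over the same symbols, drawn by the orbit of a `ν`-random `x`: the left
follows `x₀` along them, the right follows `x` itself, whose law stays `ν`. The two differ by at
most `K ^ s * ρ ^ n * A`. -/
theorem IsInvariantMeasure.tendsto_lintegral_backwardIter (hν : IsInvariantMeasure h p ν)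
    (hp : IsProbabilityVectorField p)
    (hs0 : 0 < s) (hs1 : s ≤ 1)
    (hρ : ρ < 1) (hh : ∀ i, Measurable (h i)) (hpm : ∀ i, Measurable (p i))
    (hcon : ∀ x y, ∑ i, ENNReal.ofReal (p i x) * edist (h i x) (h i y) ^ s ≤ ρ * edist x y ^ s)
    (i₀ : Fin k) (x₀ : X) (hmoment : ∫⁻ x, edist x x₀ ^ s ∂ν < ⊤)
    (hμ : ∀ a, IsForwardMeasure h p ν (μ.map (readFrom a)))
    {f : X → ℝ≥0} {K : ℝ≥0} (hf : LipschitzWith K f) (hf1 : ∀ x, f x ≤ 1) :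
    Tendsto (fun n => ∫⁻ ω, (f (backwardIter h ω n x₀) : ℝ≥0∞) ∂μ.map past) atTop
      (𝓝 (∫⁻ x, f x ∂ν)) := by
  have := hν.isProbabilityMeasure
  set A := ∫⁻ x, edist x x₀ ^ s ∂ν with hA
  have hfm : Measurable fun x => (f x : ℝ≥0∞) := hf.continuous.measurable.coe_nnreal_ennreal
  have hVm : Measurable fun x : X => edist x x₀ ^ s :=
    (measurable_id.edist measurable_const).pow_const s
  have hfin : ∫⁻ x, f x ∂ν ≠ ⊤ := by
    refine ne_top_of_le_ne_top ENNReal.one_ne_top ?_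
    calc ∫⁻ x, f x ∂ν ≤ ∫⁻ _, 1 ∂ν := lintegral_mono fun x => ENNReal.coe_le_one_iff.2 (hf1 x)
      _ = 1 := by simp
  have hwalk : ∀ n, ∫⁻ ω, (f (backwardIter h ω n x₀) : ℝ≥0∞) ∂μ.map past
      = ∫⁻ x, ∫⁻ ω, f (forwardIter h ω n x₀) ∂walk h p i₀ n x ∂ν := by
    intro n
    have hm : Measurable fun ω : ℕ → Fin k => (f (forwardIter h ω n x₀) : ℝ≥0∞) :=
      hfm.comp (measurable_forwardIter hh n x₀)
    have hread : ∀ ω : ℤ → Fin k, backwardIter h (past ω) n x₀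
        = forwardIter h (readFrom (1 - (n : ℤ)) ω) n x₀ := fun ω =>
      backwardIter_eq_forwardIter h (fun i hi => congrArg ω (by omega)) x₀
    rw [← (hμ (1 - (n : ℤ))).lintegral_eq hp hh hpm i₀ hm fun ω η hωη => by
        rw [forwardIter_congr h hωη],
      lintegral_map hm (measurable_readFrom _),
      lintegral_map (f := fun ω => (f (backwardIter h ω n x₀) : ℝ≥0∞))
        (hfm.comp (measurable_backwardIter hh n x₀)) measurable_past]
    simp only [hread]
  have hinv : ∀ n, ∫⁻ x, f x ∂ν
      = ∫⁻ x, ∫⁻ ω, f (forwardIter h ω n x) ∂walk h p i₀ n x ∂ν := by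
    intro n
    simp_rw [lintegral_walk_comp_forwardIter hh hfm n]
    exact (hν.lintegral_markovOp_iterate hh hpm hfm n).symm
  have herr : ∀ n, ∫⁻ x, ∫⁻ ω, (K : ℝ≥0∞) ^ s *
      edist (forwardIter h ω n x) (forwardIter h ω n x₀) ^ s ∂walk h p i₀ n x ∂ν
      ≤ (K : ℝ≥0∞) ^ s * (ρ ^ n * A) := by
    intro n
    calc _ ≤ ∫⁻ x, (K : ℝ≥0∞) ^ s * (ρ ^ n * edist x x₀ ^ s) ∂ν := by
          refine lintegral_mono fun x => ?_
          rw [lintegral_const_mul _ (((measurable_forwardIter hh _ _).edist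
            (measurable_forwardIter hh _ _)).pow_const s)]
          exact mul_le_mul_right (lintegral_walk_edist_forwardIter_le hh hcon n x x₀) _
      _ = _ := by
          rw [lintegral_const_mul _ (hVm.const_mul _), lintegral_const_mul _ hVm]
  -- Stated for a general pair, so that exchanging the two integrands gives the upper and the lower
  -- bound.
  have hsplit : ∀ n (g g' : X → (ℕ → Fin k) → ℝ≥0∞), (∀ x, Measurable (g' x)) →
      Measurable (fun x => ∫⁻ ω, g' x ω ∂walk h p i₀ n x) →
      (∀ x ω, g x ω ≤ g' x ω + (K : ℝ≥0∞) ^ s *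
        edist (forwardIter h ω n x) (forwardIter h ω n x₀) ^ s) →
      ∫⁻ x, ∫⁻ ω, g x ω ∂walk h p i₀ n x ∂ν ≤
        ∫⁻ x, ∫⁻ ω, g' x ω ∂walk h p i₀ n x ∂ν + (K : ℝ≥0∞) ^ s * (ρ ^ n * A) := by
    intro n g g' hg' hg'' hgg'
    calc _ ≤ ∫⁻ x, (∫⁻ ω, g' x ω ∂walk h p i₀ n x + ∫⁻ ω, (K : ℝ≥0∞) ^ s *
          edist (forwardIter h ω n x) (forwardIter h ω n x₀) ^ s ∂walk h p i₀ n x) ∂ν := by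
          refine lintegral_mono fun x => ?_
          rw [← lintegral_add_left (hg' x)]
          exact lintegral_mono fun ω => hgg' x ω
      _ ≤ _ := by
          rw [lintegral_add_left hg'']
          exact add_le_add_right (herr n) _
  have hzero : Tendsto (fun n => (K : ℝ≥0∞) ^ s * (ρ ^ n * A)) atTop (𝓝 0) := by
    have h1 := ENNReal.Tendsto.mul_const (b := A)
      (ENNReal.tendsto_pow_atTop_nhds_zero_of_lt_one hρ) (Or.inr hmoment.ne)
    rw [zero_mul] at h1
    have h2 := ENNReal.Tendsto.const_mul (a := (K : ℝ≥0∞) ^ s) h1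
      (Or.inr (ENNReal.rpow_ne_top_of_nonneg hs0.le ENNReal.coe_ne_top))
    rwa [mul_zero] at h2
  refine tendsto_of_tendsto_of_tendsto_of_le_of_le
    (g := fun n => ∫⁻ x, f x ∂ν - (K : ℝ≥0∞) ^ s * (ρ ^ n * A))
    (h := fun n => ∫⁻ x, f x ∂ν + (K : ℝ≥0∞) ^ s * (ρ ^ n * A)) ?_ ?_ (fun n => ?_) (fun n => ?_)
  · have := ENNReal.Tendsto.sub (tendsto_const_nhds (x := ∫⁻ x, f x ∂ν)) hzero (Or.inl hfin)
    rwa [tsub_zero] at this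
  · have := (tendsto_const_nhds (x := ∫⁻ x, f x ∂ν)).add hzero
    rwa [add_zero] at this
  · refine tsub_le_iff_right.2 ?_
    rw [hwalk n, hinv n]
    refine hsplit n _ _ (fun x => hfm.comp (measurable_forwardIter hh n x₀)) ?_ fun x ω =>
      coe_le_coe_add_rpow_edist hf hf1 hs0.le hs1 _ _
    exact (Measure.measurable_lintegral (hfm.comp (measurable_forwardIter hh n x₀))).comp
      (measurable_walk hh hpm n)
  · change ∫⁻ ω, (f (backwardIter h ω n x₀) : ℝ≥0∞) ∂μ.map past ≤ _
    rw [hwalk n, hinv n]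
    refine hsplit n _ _ (fun x => hfm.comp (measurable_forwardIter hh n x)) ?_ fun x ω => ?_
    · simp_rw [lintegral_walk_comp_forwardIter hh hfm n]
      exact measurable_markovOp_iterate hh hpm hfm n
    · rw [edist_comm]
      exact coe_le_coe_add_rpow_edist hf hf1 hs0.le hs1 _ _

end Coding

end PlaceDependentIFS

theorem proposition2 {X : Type*} [MetricSpace X] [CompleteSpace X] [SecondCountableTopology X]
    [MeasurableSpace X] [BorelSpace X] (x₀ : X) {k : ℕ}
    (h : Fin k → X → X) (p : Fin k → X → ℝ)
    (hp : PlaceDependentIFS.IsProbabilityVectorField p)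
    (hcoa : PlaceDependentIFS.ContractingOnAverage h p)
    (hDini : ∀ i, PlaceDependentIFS.DiniContinuous (p i))
    (hpos : PlaceDependentIFS.BoundedAwayFromZero p)
    (hLip : ∀ i, ∃ K : NNReal, LipschitzWith K (h i))
    (ν : Measure X) (hν : PlaceDependentIFS.IsInvariantMeasure h p ν) :
    ∃ (μp : Measure (ℕ → Fin k)) (μ : Measure (ℤ → Fin k)) (μm : Measure (ℕ → Fin k)),
      PlaceDependentIFS.IsForwardMeasure h p ν μp ∧
      PlaceDependentIFS.IsNaturalExtension μp μ ∧
      μm = μ.map PlaceDependentIFS.past ∧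
      IsProbabilityMeasure μm ∧
      MeasurePreserving PlaceDependentIFS.shift μm μm ∧
      (∀ᵐ ω ∂μm, ∃ y : X,
        Tendsto (fun n => PlaceDependentIFS.backwardIter h ω n x₀) atTop (𝓝 y)) ∧
      μm.map (PlaceDependentIFS.codingMap h x₀) = ν := by
  open PlaceDependentIFS in
  have := hν.isProbabilityMeasure
  have hh : ∀ i, Measurable (h i) := fun i => (hLip i).choose_spec.continuous.measurable
  have hpm : ∀ i, Measurable (p i) := fun i => (hDini i).continuous.measurable
  obtain ⟨i₀⟩ : Nonempty (Fin k) := by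
    by_contra hempty
    rw [not_nonempty_iff] at hempty
    simpa using (hp x₀).2
  obtain ⟨s, ρ, hs0, hs1, hρ, hcon⟩ := hcoa.exists_sum_mul_edist_rpow_le hp hpos hLip
  have hmoment : ∫⁻ x, edist x x₀ ^ s ∂ν < ⊤ :=
    hν.lintegral_lt_top_of_drift hp hh hpm ((measurable_id.edist measurable_const).pow_const s)
      (fun x => ENNReal.rpow_ne_top_of_nonneg hs0.le (edist_ne_top _ _)) hρ
      (ENNReal.sum_ne_top.2 fun i _ => ENNReal.rpow_ne_top_of_nonneg hs0.le (edist_ne_top _ _))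
      (markovOp_edist_rpow_le hp hs0.le hs1 hcon x₀)
  obtain ⟨μ, hμprob, hμ⟩ := hν.exists_twoSided hp hh hpm i₀
  have hfuture : (future : (ℤ → Fin k) → ℕ → Fin k) = readFrom 1 :=
    funext fun ω => funext fun n => congrArg ω (add_comm _ _)
  have hshift := measurePreserving_shiftZ i₀ hμ
  have hpast := Measure.isProbabilityMeasure_map (μ := μ) measurable_past.aemeasurable
  have hconv : ∀ᵐ ω ∂μ.map past, ∃ y : X,
      Tendsto (fun n => backwardIter h ω n x₀) atTop (𝓝 y) :=
    (ae_cauchySeq_backwardIter hp hs0 hs1 hρ hh hpm hcon i₀ x₀ hmoment hμ).mono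
      fun ω hω => cauchySeq_tendsto_of_complete hω
  have hcoding : ∀ᵐ ω ∂μ.map past,
      Tendsto (fun n => backwardIter h ω n x₀) atTop (𝓝 (codingMap h x₀ ω)) :=
    hconv.mono fun ω hω => tendsto_nhds_limUnder hω
  -- Off the set of convergence `codingMap` is arbitrary, so measurability is obtained only almost
  -- everywhere.
  have hcm : AEMeasurable (codingMap h x₀) (μ.map past) :=
    aemeasurable_of_tendsto_metrizable_ae atTop
      (fun n => (measurable_backwardIter hh n x₀).aemeasurable) hcoding
  refine ⟨μ.map future, μ, μ.map past, hfuture ▸ hμ 1, ⟨hshift, rfl⟩, rfl, hpast,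
    measurePreserving_shift_map_past hshift, hconv, ?_⟩
  have := Measure.isProbabilityMeasure_map hcm
  refine ext_of_lintegral_thickenedIndicator fun f K hf hf1 => ?_
  have hfm : Measurable fun x => (f x : ENNReal) := f.continuous.measurable.coe_nnreal_ennreal
  rw [lintegral_map' hfm.aemeasurable hcm]
  -- Both integrals are limits of the means of `f` over backward iterates: one by dominated
  -- convergence, the other by invariance of `ν`.
  refine tendsto_nhds_unique ?_
    (hν.tendsto_lintegral_backwardIter hp hs0 hs1 hρ hh hpm hcon i₀ x₀ hmoment hμ hf hf1)
  refine tendsto_lintegral_of_dominated_convergence (fun _ => 1)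
    (fun n => hfm.comp (measurable_backwardIter hh n x₀))
    (fun n => Eventually.of_forall fun ω => ENNReal.coe_le_one_iff.2 (hf1 _)) (by simp) ?_
  filter_upwards [hcoding] with ω hω
  exact ENNReal.tendsto_coe.2 ((f.continuous.tendsto _).comp hω)
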